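/- Signals are elements $x$ of $L_2(\mathbf R)=L_2(\mathbf R;\mathbf C)$, with Fourier transform $X(i\omega)=\int_{\mathbf R} e^{-i\omega t}x(t)\,dt$ (in the $L_2$ sense); real-valued signals are a special case. Let $\mathcal K$ be the set of integrable $\kappa:\mathbf R\to\mathbf R$ with $\kappa(t)=0$ for $t>0$ for which there are an integer $m>0$, numbers $a_1,\dots,a_m>0$ and a polynomial $d$ with $\deg d<m$ such that $\int_{\mathbf R} e^{-i\omega t}\kappa(t)\,dt=d(i\omega)/\prod_{j=1}^m(i\omega-a_j)$ for all $\omega\in\mathbf R$. Let $\widehat{\mathcal K}$ be the set of $\widehat\kappa:\mathbf R\to\mathbf R$ in $L_2(\mathbf R)$ with $\widehat\kappa(t)=0$ for $t<0$ whose Laplace transform $z\mapsto\int_0^\infty e^{-zt}\widehat\kappa(t)\,dt$ lies in $H^2\cap H^\infty$, where $H^p$ is the Hardy space of functions $Q$ that are holomorphic on $\{\operatorname{Re} z>0\}$ and satisfy $\sup_{s>0}\|Q(s+i\,\cdot)\|_{L_p(\mathbf R)}<\infty$. Write $\circ$ for convolution on $\mathbf R$. A class $\bar{\mathcal X}\subset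 L_2(\mathbf R)$ is called weakly predictable (in $L_2$) if for every $\kappa\in\mathcal K$ there is a sequence $(\widehat\kappa_j)_{j\ge1}\subset\widehat{\mathcal K}$ such that $\|\kappa\circ x-\widehat\kappa_j\circ x\|_{L_2(\mathbf R)}\to0$ as $j\to\infty$ for every $x\in\bar{\mathcal X}$. Say that a class $\mathcal C\subset L_2(\mathbf R)$ is determined by the past if, for every $s\in\mathbf R$ and all $x,x'\in\mathcal C$, $x=x'$ a.e. on $(-\infty,s]$ implies $x=x'$ a.e. on $\mathbf R$. **Proposition 1.** (i) If $\bar{\mathcal X}\subset L_2(\mathbf R)$ is weakly predictable, then its complex linear span is determined by the past. In particular, for every $s\in\mathbf R$, each $x\in\bar{\mathcal X}$ is uniquely determined in $\bar{\mathcal X}$ by $x|_{t\le s}$, and an $x\in\bar{\mathcal X}$ that vanishes on $(-\infty,s]$ is zero. (ii) There are $a>0$ and a set $\mathcal U=\{x_1,x_2\}\subset L_2(\mathbf R)$ of real-valued functions with Fourier transforms $X_1,X_2$ such that $X_1(i\omega)=0$ for a.e. $|\omega|\ge a$ ($x_1$ is band-limited) and $X_2(i\omega)=0$ for a.e. $|\omega|<a$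 ($x_2$ has a spectral gap at the origin), with the following properties. (a) The members of $\mathcal U$ are uniquely determined by their past: the class of all $x\in L_2(\mathbf R)$ with $X(i\omega)=0$ for a.e. $|\omega|\ge a$, the class of all $x\in L_2(\mathbf R)$ with $X(i\omega)=0$ for a.e. $|\omega|<a$, and the complex linear span of $\mathcal U$ are each determined by the past. (b) $\mathcal U$ is not weakly predictable. -/

import Mathlib

open MeasureTheory Filter Topology
open scoped FourierTransform ENNReal

noncomputable section

namespace WeakPrediction

/-- Complex valued signals in `L₂(ℝ)`, as almost everywhere classes. -/
abbrev Signal : Type := Lp ℂ 2 (volume : Measure ℝ)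

/-- The anti-causal kernels `κ : ℝ → ℝ`: they vanish on `(0, ∞)`, and their Fourier transform
`∫ e^{-iωt} κ(t) dt` is `d(iω) / ∏ⱼ (iω - aⱼ)` for some `m > 0`, `a₁, …, aₘ > 0` and a polynomial
`d` of degree less than `m`. -/
def antiCausalKernels : Set (ℝ → ℝ) :=
  {κ | (∀ t, 0 < t → κ t = 0) ∧ Integrable κ ∧
    ∃ (m : ℕ) (a : Fin m → ℝ) (d : Polynomial ℂ), 0 < m ∧ (∀ j, 0 < a j) ∧ d.degree < m ∧
      ∀ ω : ℝ, ∫ t : ℝ, Complex.exp (-(Complex.I * ω * t)) * (κ t : ℂ) =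
        d.eval (Complex.I * ω) / ∏ j, (Complex.I * ω - (a j : ℂ))}

/-- The open right half-plane. -/
def rightHalfPlane : Set ℂ := {z | 0 < z.re}

/-- Membership in the Hardy space `H^p` of the right half-plane. -/
def MemHardy (p : ℝ≥0∞) (Q : ℂ → ℂ) : Prop :=
  DifferentiableOn ℂ Q rightHalfPlane ∧
    (⨆ (s : ℝ) (_ : 0 < s), eLpNorm (fun ω : ℝ => Q (s + Complex.I * ω)) p volume) < ∞

/-- The Laplace transform `∫₀^∞ e^{-zt} k(t) dt`. -/
def laplaceTransform (k : ℝ → ℝ) (z : ℂ) : ℂ :=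
  ∫ t in Set.Ioi (0 : ℝ), Complex.exp (-(z * t)) * (k t : ℂ)

/-- The causal kernels `k : ℝ → ℝ`: square integrable, vanishing on `(-∞, 0)`, with Laplace
transform in `H² ∩ H^∞`. -/
def causalKernels : Set (ℝ → ℝ) :=
  {k | (∀ t, t < 0 → k t = 0) ∧ MemLp k 2 volume ∧
    MemHardy 2 (laplaceTransform k) ∧ MemHardy ∞ (laplaceTransform k)}

/-- The convolution `(k ∘ x)(t) = ∫ k(s) x(t - s) ds` of a real kernel with a signal. -/
def conv (k : ℝ → ℝ) (x : Signal) : ℝ → ℂ :=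
  convolution k x (ContinuousLinearMap.lsmul ℝ ℝ) volume

/-- Predictability in the weak sense, in `L₂(ℝ)`: for every anti-causal `κ` there is one sequence
of causal kernels `k j` such that `k j ∘ x → κ ∘ x` in `L₂(ℝ)` for every `x` in the class. -/
def WeaklyPredictable (X : Set Signal) : Prop :=
  ∀ κ ∈ antiCausalKernels, ∃ k : ℕ → ℝ → ℝ, (∀ j, k j ∈ causalKernels) ∧
    ∀ x ∈ X, Tendsto (fun j => eLpNorm (conv κ x - conv (k j) x) 2 volume) atTop (𝓝 0)

/-- For every `s`, the members of the class `X` are uniquely determined within `X` by their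
paths on `(-∞, s]`. -/
def DeterminedByPast (X : Set Signal) : Prop :=
  ∀ s : ℝ, ∀ x ∈ X, ∀ x' ∈ X, (∀ᵐ t : ℝ, t ≤ s → x t = x' t) → x = x'

/-- `x` is real valued. -/
def IsRealValued (x : Signal) : Prop := ∀ᵐ t : ℝ, (x t).im = 0

/-- The spectrum of `x` vanishes at the angular frequencies `ω` with `|ω| ≥ a`. In Mathlib's
normalization of the `L₂` Fourier transform `𝓕`, the variable is `ξ = ω / (2π)`. -/
def BandLimited (a : ℝ) (x : Signal) : Prop :=
  ∀ᵐ ξ : ℝ, a ≤ |2 * Real.pi * ξ| → (𝓕 x : Signal) ξ = 0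

/-- The spectrum of `x` vanishes at the angular frequencies `ω` with `|ω| < a`. -/
def HasSpectralGap (a : ℝ) (x : Signal) : Prop :=
  ∀ᵐ ξ : ℝ, |2 * Real.pi * ξ| < a → (𝓕 x : Signal) ξ = 0

end WeakPrediction

end

/-! Part (i). Let `x` vanish before `s`. Up to time `s` a causal convolution of `x` is zero, while
convolution with the anti-causal kernel `e^{pt}`, `t ≤ 0`, gives `e^{pt}` times the Laplace
transform of `x` at `p`. If the former approximate the latter in `L₂`, the Laplace transform
vanishes at `p`; taking `p = 1, 2, …`, Weierstrass approximation in the variable `e^{s - r}` gives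
`x = 0` (`integral_exp_smul_eq_zero_of_tendsto`, `ae_eq_zero_of_laplace_eq_zero`). Since one kernel
sequence serves the whole class, it also serves the linear span.

Part (ii). Split the indicator of `[0, 1]` into a low and a high frequency part, and delay only the
high part by one: these are `x₁` and `x₂`. Convolution commutes with translation, so kernels
predicting `x₁` and `x₂` also predict the undelayed high part, hence the indicator itself, and the
argument of (i) forbids this.

The past still determines the span. A signal that vanishes before `s` and whose spectrum vanishes on
an interval is zero (`eq_zero_of_past_of_spectrum`): the Cauchy transform of the spectrum is a
Laplace transform on the right half-plane, zero on the left, and holomorphic across the gap. If `c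
x₁ + d x₂` vanishes in the past, subtracting `c` times the indicator leaves a signal with a spectral
gap and a vanishing past, hence zero. Unless `c = d = 0`, the high part is then an eigenvector of a
translation, which is impossible in `L₂`. -/

noncomputable section

namespace WeakPrediction

/-! ### The `L²` Fourier transform as an integral -/

section

open scoped ContDiff

/-- The `L²` Fourier transform of an integrable function is its Fourier integral. -/
theorem coeFn_fourier_ae_eq (f : Signal) (hf : Integrable f) :
    ((𝓕 f : Signal) : ℝ → ℂ) =ᵐ[volume] 𝓕 (f : ℝ → ℂ) := by
  have hc : Continuous (𝓕 (f : ℝ → ℂ)) :=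
    VectorFourier.fourierIntegral_continuous Real.continuous_fourierChar
      (L := innerₗ ℝ) continuous_inner hf
  -- It suffices to test against bump functions: the `L²` transform agrees with the distributional
  -- one, and Fubini moves the transform between the test function and `f`.
  refine ae_eq_of_integral_contDiff_smul_eq
    ((Lp.memLp (𝓕 f : Signal)).locallyIntegrable (by norm_num)) hc.locallyIntegrable ?_
  intro g g_smooth g_cpt
  have hg₁ : HasCompactSupport (Complex.ofRealCLM ∘ g) := g_cpt.comp_left rfl
  have hg₂ : ContDiff ℝ ∞ (Complex.ofRealCLM ∘ g) := by fun_prop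
  set φ := hg₁.toSchwartzMap hg₂ with hφ
  have hv : ∀ x, φ x = (g x : ℂ) := fun x => rfl
  have key := congrArg (fun T => T φ) (Lp.fourier_toTemperedDistribution_eq f)
  simp only [TemperedDistribution.fourier_apply, Lp.toTemperedDistribution_apply] at key
  have h2 : ∫ x, (𝓕 φ) x • f x = ∫ x, φ x • 𝓕 (f : ℝ → ℂ) x := by
    rw [SchwartzMap.fourier_coe]
    simpa using! (VectorFourier.integral_fourierIntegral_smul_eq_flip (L := innerₗ ℝ)
      Real.continuous_fourierChar continuous_inner φ.integrable hf)
  rw [h2] at key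
  simp only [hv, Complex.coe_smul] at key
  exact key.symm

theorem coeFn_fourierInv_ae_eq (f : Signal) (hf : Integrable f) :
    ((𝓕⁻ f : Signal) : ℝ → ℂ) =ᵐ[volume] 𝓕⁻ (f : ℝ → ℂ) := by
  have hc : Continuous (𝓕⁻ (f : ℝ → ℂ)) := by
    have : Continuous (𝓕 (f : ℝ → ℂ)) :=
      VectorFourier.fourierIntegral_continuous Real.continuous_fourierChar
        (L := innerₗ ℝ) continuous_inner hf
    have h2 : 𝓕⁻ (f : ℝ → ℂ) = fun w => 𝓕 (f : ℝ → ℂ) (-w) := by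
      ext w; exact Real.fourierInv_eq_fourier_neg _ _
    rw [h2]
    exact this.comp continuous_neg
  refine ae_eq_of_integral_contDiff_smul_eq
    ((Lp.memLp (𝓕⁻ f : Signal)).locallyIntegrable (by norm_num)) hc.locallyIntegrable ?_
  intro g g_smooth g_cpt
  have hg₁ : HasCompactSupport (Complex.ofRealCLM ∘ g) := g_cpt.comp_left rfl
  have hg₂ : ContDiff ℝ ∞ (Complex.ofRealCLM ∘ g) := by fun_prop
  set φ := hg₁.toSchwartzMap hg₂ with hφ
  have hv : ∀ x, φ x = (g x : ℂ) := fun x => rfl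
  have key := congrArg (fun T => T φ) (Lp.fourierInv_toTemperedDistribution_eq f)
  simp only [TemperedDistribution.fourierInv_apply, Lp.toTemperedDistribution_apply] at key
  have h2 : ∫ x, (𝓕⁻ φ) x • f x = ∫ x, φ x • 𝓕⁻ (f : ℝ → ℂ) x := by
    rw [SchwartzMap.fourierInv_coe]
    have hfl : (-innerₗ ℝ).flip = -innerₗ ℝ := by
      ext
      simp
    have h3 := VectorFourier.integral_fourierIntegral_smul_eq_flip (L := -innerₗ ℝ)
      Real.continuous_fourierChar (by simpa using! continuous_inner.neg)
      (φ.integrable (μ := volume)) hf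
    rw [hfl] at h3
    exact h3
  rw [h2] at key
  simp only [hv, Complex.coe_smul] at key
  exact key.symm

/-! ### Completeness of the exponentials on a half-line -/

/-- A compactly supported continuous function is, on `(s, ∞)`, a uniform limit of polynomials in
`exp (s - r)`. -/
theorem exists_polynomial_exp_near {g : ℝ → ℝ} (hg : Continuous g) (hgc : HasCompactSupport g)
    (s : ℝ) {ε : ℝ} (hε : 0 < ε) :
    ∃ p : Polynomial ℝ, ∀ r, s < r → |p.eval (Real.exp (s - r)) - g r| < ε := by
  obtain ⟨B, hB⟩ : ∃ B : ℝ, ∀ r, B < r → g r = 0 := by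
    obtain ⟨B, hB⟩ := hgc.isCompact.bddAbove
    exact ⟨B, fun r hr => image_eq_zero_of_notMem_tsupport fun h => absurd (hB h) (not_le.2 hr)⟩
  -- The substitution `u = exp (s - r)` carries `(s, ∞)` to `(0, 1)`. Since `g` vanishes for large
  -- `r`, extension by zero is continuous at `u = 0`, and Weierstrass applies on `[0, 1]`.
  let G : ℝ → ℝ := fun u => if u ≤ 0 then 0 else g (s - Real.log u)
  have hG0 : ∀ u, u < Real.exp (s - B) → G u = 0 := by
    intro u hu
    by_cases h : u ≤ 0
    · simp [G, h]
    · have : Real.log u < s - B := by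
        rw [Real.log_lt_iff_lt_exp (not_le.1 h)]; exact hu
      simp only [G, h, if_false]
      exact hB _ (by linarith)
  have hG : Continuous G := by
    rw [continuous_iff_continuousAt]
    intro u
    rcases lt_or_ge u (Real.exp (s - B)) with h | h
    · have : G =ᶠ[𝓝 u] fun _ => 0 := by
        filter_upwards [Iio_mem_nhds h] with v hv using hG0 v hv
      exact this.continuousAt
    · have hu : 0 < u := (Real.exp_pos _).trans_le h
      have : G =ᶠ[𝓝 u] fun v => g (s - Real.log v) := by
        filter_upwards [Ioi_mem_nhds hu] with v hv
        simp [G, not_le.2 (Set.mem_Ioi.1 hv)]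
      refine ContinuousAt.congr ?_ this.symm
      exact hg.continuousAt.comp (continuousAt_const.sub (Real.continuousAt_log hu.ne'))
  obtain ⟨p, hp⟩ := exists_polynomial_near_of_continuousOn 0 1 G hG.continuousOn ε hε
  refine ⟨p, fun r hr => ?_⟩
  have h := hp (Real.exp (s - r)) ⟨(Real.exp_pos _).le, Real.exp_le_one_iff.2 (by linarith)⟩
  simpa [G, not_le.2 (Real.exp_pos (s - r))] using h

/-- An integrable function on `(s, ∞)` orthogonal to all `exp (-n r)` vanishes. -/
theorem ae_eq_zero_of_integral_exp_smul_eq_zero {s : ℝ} {h : ℝ → ℂ}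
    (hh : IntegrableOn h (Set.Ioi s))
    (h0 : ∀ n : ℕ, ∫ r in Set.Ioi s, Real.exp (-(n * r)) • h r = 0) :
    ∀ᵐ r : ℝ, s < r → h r = 0 := by
  have hint : ∀ n : ℕ, IntegrableOn (fun r => Real.exp (s - r) ^ n • h r) (Set.Ioi s) := by
    intro n
    refine Integrable.bdd_smul (φ := fun r => Real.exp (s - r) ^ n) hh 1
      (by fun_prop) ?_
    filter_upwards [ae_restrict_mem measurableSet_Ioi] with r hr
    rw [Real.norm_eq_abs, abs_of_nonneg (by positivity)]
    exact pow_le_one₀ (Real.exp_pos _).le (Real.exp_le_one_iff.2 (by linarith [Set.mem_Ioi.1 hr]))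
  have hpow : ∀ n : ℕ, ∫ r in Set.Ioi s, Real.exp (s - r) ^ n • h r = 0 := by
    intro n
    have : ∀ r : ℝ, Real.exp (s - r) ^ n • h r
        = Real.exp (n * s) • Real.exp (-(n * r)) • h r := by
      intro r
      rw [smul_smul, ← Real.exp_add, ← Real.exp_nat_mul]
      ring_nf
    simp_rw [this, integral_smul, h0, smul_zero]
  have hpoly : ∀ p : Polynomial ℝ,
      IntegrableOn (fun r => p.eval (Real.exp (s - r)) • h r) (Set.Ioi s) ∧
      ∫ r in Set.Ioi s, p.eval (Real.exp (s - r)) • h r = 0 := by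
    intro p
    have he : ∀ r : ℝ, p.eval (Real.exp (s - r)) • h r
        = ∑ i ∈ Finset.range (p.natDegree + 1), p.coeff i • Real.exp (s - r) ^ i • h r := by
      intro r
      rw [Polynomial.eval_eq_sum_range, Finset.sum_smul]
      simp_rw [mul_smul]
    simp_rw [he]
    have hi : ∀ i ∈ Finset.range (p.natDegree + 1), Integrable
        (fun r => p.coeff i • Real.exp (s - r) ^ i • h r) (volume.restrict (Set.Ioi s)) :=
      fun i _ => (hint i).smul (p.coeff i)
    refine ⟨integrable_finsetSum _ hi, ?_⟩
    rw [integral_finsetSum _ hi]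
    refine Finset.sum_eq_zero fun i _ => ?_
    rw [integral_smul, hpow, smul_zero]
  have hz : ∀ᵐ r : ℝ, (Set.Ioi s).indicator h r = 0 := by
    refine ae_eq_zero_of_integral_contDiff_smul_eq_zero
      ((integrable_indicator_iff measurableSet_Ioi).2 hh).locallyIntegrable ?_
    intro g hg hgc
    have hgi : IntegrableOn (fun r => g r • h r) (Set.Ioi s) := by
      obtain ⟨C, hC⟩ := hgc.exists_bound_of_continuous hg.continuous
      exact Integrable.bdd_smul hh C hg.continuous.aestronglyMeasurable
        (ae_of_all _ hC)
    have e1 : ∫ r, g r • (Set.Ioi s).indicator h r = ∫ r in Set.Ioi s, g r • h r := by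
      rw [← integral_indicator measurableSet_Ioi]
      congr 1 with r
      by_cases hr : r ∈ Set.Ioi s <;> simp [hr]
    rw [e1]
    set N := ∫ r in Set.Ioi s, ‖h r‖ with hN
    have hN0 : 0 ≤ N := integral_nonneg fun _ => norm_nonneg _
    -- Orthogonality to polynomials in `exp (s - r)` allows `g` to be replaced by its uniformly
    -- small error `g - p`.
    have hle : ∀ ε : ℝ, 0 < ε → ‖∫ r in Set.Ioi s, g r • h r‖ ≤ ε * N := by
      intro ε hε
      obtain ⟨p, hp⟩ := exists_polynomial_exp_near hg.continuous hgc s hε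
      have : ∫ r in Set.Ioi s, g r • h r
          = ∫ r in Set.Ioi s, (g r • h r - p.eval (Real.exp (s - r)) • h r) := by
        rw [integral_sub hgi (hpoly p).1, (hpoly p).2, sub_zero]
      rw [this, hN, ← integral_const_mul]
      refine norm_integral_le_of_norm_le (hh.norm.const_mul _) ?_
      filter_upwards [ae_restrict_mem measurableSet_Ioi] with r hr
      rw [← sub_smul, norm_smul, Real.norm_eq_abs, abs_sub_comm]
      gcongr
      exact (hp r hr).le
    by_contra hne
    have hpos : 0 < ‖∫ r in Set.Ioi s, g r • h r‖ := norm_pos_iff.2 hne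
    have := hle (‖∫ r in Set.Ioi s, g r • h r‖ / (2 * (N + 1))) (by positivity)
    rw [div_mul_eq_mul_div, le_div_iff₀ (by positivity)] at this
    nlinarith
  filter_upwards [hz] with r hr hs
  simpa [Set.mem_Ioi.2 hs] using hr

end

/-! ### Convolution with square integrable kernels -/

theorem convolutionExists_of_memLp {k : ℝ → ℝ} (hk : MemLp k 2 volume) (x : Signal) :
    ConvolutionExists k x (ContinuousLinearMap.lsmul ℝ ℝ) volume := by
  intro t
  have hx : MemLp (fun u => x (t - u)) 2 volume :=
    (Lp.memLp x).comp_measurePreserving (Measure.measurePreserving_sub_left volume t)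
  exact memLp_one_iff_integrable.1 (MemLp.smul (p := 2) (q := 2) (r := 1) hx hk)

theorem conv_add {k : ℝ → ℝ} (hk : MemLp k 2 volume) (x y : Signal) :
    conv k (x + y) = conv k x + conv k y := by
  unfold conv
  rw [convolution_congr _ (EventuallyEq.refl _ k) (Lp.coeFn_add x y)]
  exact (convolutionExists_of_memLp hk x).distrib_add (convolutionExists_of_memLp hk y)

theorem conv_smul (k : ℝ → ℝ) (c : ℂ) (x : Signal) : conv k (c • x) = c • conv k x := by
  unfold conv
  rw [convolution_congr _ (EventuallyEq.refl _ k) (Lp.coeFn_smul c x)]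
  ext t
  simp only [convolution_def, Pi.smul_apply, ContinuousLinearMap.lsmul_apply, ← integral_smul]
  simp_rw [smul_comm c]

theorem conv_zero (k : ℝ → ℝ) : conv k (0 : Signal) = 0 := by
  simpa using conv_smul k 0 (0 : Signal)

theorem aestronglyMeasurable_conv {k : ℝ → ℝ} (hk : MemLp k 2 volume) (x : Signal) :
    AEStronglyMeasurable (conv k x) volume :=
  (hk.1.convolution_integrand (ContinuousLinearMap.lsmul ℝ ℝ) (Lp.memLp x).1).integral_prod_right'

/-- The signals on which the kernels `k j` approximate `κ` in `L²` form a subspace. -/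
def predictedSubspace (κ : ℝ → ℝ) (k : ℕ → ℝ → ℝ) (hκ : MemLp κ 2 volume)
    (hk : ∀ j, MemLp (k j) 2 volume) : Submodule ℂ Signal where
  carrier := {x | Tendsto (fun j => eLpNorm (conv κ x - conv (k j) x) 2 volume) atTop (𝓝 0)}
  zero_mem' := by simp [conv_zero]
  add_mem' := by
    intro x y hx hy
    have h := Tendsto.add hx hy
    rw [add_zero] at h
    refine tendsto_of_tendsto_of_tendsto_of_le_of_le tendsto_const_nhds h (fun _ => zero_le) ?_
    intro j
    have : conv κ (x + y) - conv (k j) (x + y)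
        = (conv κ x - conv (k j) x) + (conv κ y - conv (k j) y) := by
      rw [conv_add hκ, conv_add (hk j)]; abel
    simp only [this]
    exact eLpNorm_add_le
      ((aestronglyMeasurable_conv hκ x).sub (aestronglyMeasurable_conv (hk j) x))
      ((aestronglyMeasurable_conv hκ y).sub (aestronglyMeasurable_conv (hk j) y)) (by norm_num)
  smul_mem' := by
    intro c x hx
    have h := ENNReal.Tendsto.const_mul (a := ‖c‖ₑ) hx (Or.inr enorm_ne_top)
    rw [mul_zero] at h
    refine h.congr fun j => ?_
    rw [conv_smul, conv_smul, ← smul_sub, eLpNorm_const_smul]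

/-- Convolution with a causal kernel does not anticipate. -/
theorem conv_eq_zero_of_causal {k : ℝ → ℝ} (hk : ∀ t, t < 0 → k t = 0) {x : Signal} {s : ℝ}
    (hx : ∀ᵐ t : ℝ, t ≤ s → x t = 0) {t : ℝ} (ht : t ≤ s) : conv k x t = 0 := by
  unfold conv
  rw [convolution_def]
  refine integral_eq_zero_of_ae ?_
  have h := (Measure.measurePreserving_sub_left volume t).quasiMeasurePreserving.ae hx
  filter_upwards [h] with u hu
  rcases lt_or_ge u 0 with h0 | h0
  · simp [hk u h0]
  · simp [hu (by linarith)]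

/-! ### Anti-causal exponentials and part (i) -/

/-- The anti-causal exponential `e^{pt}`, `t ≤ 0`. -/
def expKernel (p : ℝ) : ℝ → ℝ := (Set.Iic 0).indicator fun t => Real.exp (p * t)

theorem integrable_expKernel {p : ℝ} (hp : 0 < p) : Integrable (expKernel p) :=
  (integrable_indicator_iff measurableSet_Iic).2 (integrableOn_exp_mul_Iic hp 0)

theorem memLp_expKernel {p : ℝ} (hp : 0 < p) : MemLp (expKernel p) 2 volume := by
  rw [memLp_two_iff_integrable_sq (integrable_expKernel hp).1]
  refine (integrable_expKernel (p := 2 * p) (by positivity)).congr (ae_of_all _ fun t => ?_)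
  by_cases h : t ∈ Set.Iic (0 : ℝ)
  · simp only [expKernel, Set.indicator_of_mem h]
    rw [← Real.exp_nat_mul]
    push_cast
    ring_nf
  · simp [expKernel, Set.indicator_of_notMem h]

theorem expKernel_mem_antiCausalKernels {p : ℝ} (hp : 0 < p) :
    expKernel p ∈ antiCausalKernels := by
  -- The transform is `1 / (p - iω) = -1 / (iω - p)`, whence `m = 1` and `d = -1`.
  refine ⟨fun t ht => by simp [expKernel, ht], integrable_expKernel hp, 1, fun _ => p, -1,
    one_pos, fun _ => hp, ?_, fun ω => ?_⟩
  · simp [Polynomial.degree_neg]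
  · have h1 : ∀ t : ℝ, Complex.exp (-(Complex.I * ω * t)) * (expKernel p t : ℂ)
        = (Set.Iic (0 : ℝ)).indicator (fun t : ℝ => Complex.exp ((p - Complex.I * ω) * t)) t := by
      intro t
      by_cases h : t ∈ Set.Iic (0 : ℝ)
      · simp only [expKernel, Set.indicator_of_mem h, Complex.ofReal_exp, ← Complex.exp_add]
        push_cast
        ring_nf
      · simp [expKernel, Set.indicator_of_notMem h]
    simp_rw [h1]
    rw [integral_indicator measurableSet_Iic, integral_exp_mul_complex_Iic (by simpa using hp)]
    have h2 : (p : ℂ) - Complex.I * ω ≠ 0 := by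
      intro h
      have := congrArg Complex.re h
      simp at this
      exact hp.ne' this
    have h3 : Complex.I * ω - (p : ℂ) ≠ 0 := by
      rw [← neg_sub]; exact neg_ne_zero.2 h2
    simp only [Finset.univ_unique, Finset.prod_singleton, Polynomial.eval_neg,
      Polynomial.eval_one, Complex.ofReal_zero, mul_zero, Complex.exp_zero]
    rw [div_eq_div_iff h2 h3]
    ring

/-- For a signal vanishing before `s`, the anti-causal exponential averages are given, up to time
`s`, by the Laplace transform of the signal. -/
theorem conv_expKernel {p : ℝ} {x : Signal} {s : ℝ} (hx : ∀ᵐ t : ℝ, t ≤ s → x t = 0) {t : ℝ}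
    (ht : t ≤ s) :
    conv (expKernel p) x t = Real.exp (p * t) • ∫ r in Set.Ioi s, Real.exp (-(p * r)) • x r := by
  unfold conv
  rw [convolution_lsmul_swap, ← integral_indicator measurableSet_Ioi, ← integral_smul]
  refine integral_congr_ae ?_
  filter_upwards [hx] with r hr
  by_cases h : r ∈ Set.Ioi s
  · have h' : t - r ∈ Set.Iic (0 : ℝ) := by
      have := Set.mem_Ioi.1 h
      simp; linarith
    rw [Set.indicator_of_mem h, expKernel, Set.indicator_of_mem h', smul_smul, ← Real.exp_add]
    ring_nf
  · rw [Set.indicator_of_notMem h, hr (by simpa using h)]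
    simp

/-- On `(-∞, s]` every error equals the same function `e^{pt} A`, with `A` the integral in question.
Its norm there bounds all the errors from below, so it is zero. -/
theorem integral_exp_smul_eq_zero_of_tendsto {p : ℝ} {k : ℕ → ℝ → ℝ}
    (hk : ∀ j, k j ∈ causalKernels) {x : Signal} {s : ℝ} (hx : ∀ᵐ t : ℝ, t ≤ s → x t = 0)
    (hlim : Tendsto (fun j => eLpNorm (conv (expKernel p) x - conv (k j) x) 2 volume)
      atTop (𝓝 0)) :
    ∫ r in Set.Ioi s, Real.exp (-(p * r)) • x r = 0 := by
  set A := ∫ r in Set.Ioi s, Real.exp (-(p * r)) • x r with hA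
  set μ := volume.restrict (Set.Iic s) with hμ
  have hae : ∀ j, conv (expKernel p) x - conv (k j) x =ᵐ[μ] fun t => Real.exp (p * t) • A := by
    intro j
    filter_upwards [ae_restrict_mem measurableSet_Iic] with t ht
    rw [Pi.sub_apply, conv_eq_zero_of_causal (hk j).1 hx ht, sub_zero, conv_expKernel hx ht]
  have hle : ∀ j, eLpNorm (fun t : ℝ => Real.exp (p * t) • A) 2 μ
      ≤ eLpNorm (conv (expKernel p) x - conv (k j) x) 2 volume := by
    intro j
    rw [← eLpNorm_congr_ae (hae j)]
    exact eLpNorm_mono_measure _ Measure.restrict_le_self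
  have h0 : eLpNorm (fun t : ℝ => Real.exp (p * t) • A) 2 μ = 0 :=
    le_antisymm (ge_of_tendsto' hlim hle) zero_le
  rw [eLpNorm_eq_zero_iff (by fun_prop) (by norm_num)] at h0
  have : NeZero μ := ⟨by rw [hμ, Ne, Measure.restrict_eq_zero, Real.volume_Iic]; simp⟩
  obtain ⟨t, ht⟩ := h0.exists
  simpa [(Real.exp_pos _).ne'] using ht

/-- Up to the factor `e^{-ps}`, this is the integrand of the convolution with `expKernel p` at time
`s`. -/
theorem integrableOn_exp_smul (x : Signal) {p : ℝ} (hp : 0 < p) (s : ℝ) :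
    IntegrableOn (fun r => Real.exp (-(p * r)) • x r) (Set.Ioi s) := by
  have h := ((convolutionExists_of_memLp (memLp_expKernel hp) x) s).integrable_swap
  have h2 := (h.integrableOn (s := Set.Ioi s)).smul (Real.exp (-(p * s)))
  refine IntegrableOn.congr_fun h2 (fun r hr => ?_) measurableSet_Ioi
  have h' : s - r ∈ Set.Iic (0 : ℝ) := by
    have := Set.mem_Ioi.1 hr
    simp; linarith
  simp only [Pi.smul_apply, ContinuousLinearMap.lsmul_apply, expKernel, Set.indicator_of_mem h']
  rw [smul_smul, ← Real.exp_add]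
  ring_nf

/-- A signal that vanishes before `s` and whose Laplace transform vanishes at the positive
integers is zero. -/
theorem ae_eq_zero_of_laplace_eq_zero {x : Signal} {s : ℝ}
    (h : ∀ n : ℕ, ∫ r in Set.Ioi s, Real.exp (-((n + 1 : ℝ) * r)) • x r = 0) :
    ∀ᵐ r : ℝ, s < r → x r = 0 := by
  -- `x` itself need not be integrable on the half-line, so one factor `e^{-r}` is absorbed into it;
  -- this accounts for `n + 1` in place of `n`.
  have hi : IntegrableOn (fun r => Real.exp (-(1 * r)) • x r) (Set.Ioi s) :=
    integrableOn_exp_smul x one_pos s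
  have := ae_eq_zero_of_integral_exp_smul_eq_zero hi (fun n => by
    rw [← h n]
    congr 1 with r
    rw [smul_smul, ← Real.exp_add]
    ring_nf)
  filter_upwards [this] with r hr hs
  simpa [(Real.exp_pos _).ne'] using hr hs

theorem determinedByPast_of_sub_mem {X : Set Signal} (hX : ∀ x ∈ X, ∀ x' ∈ X, x - x' ∈ X)
    (h : ∀ s : ℝ, ∀ x ∈ X, (∀ᵐ t : ℝ, t ≤ s → x t = 0) → x = 0) : DeterminedByPast X := by
  intro s x hx x' hx' hxx
  refine sub_eq_zero.1 (h s _ (hX x hx x' hx') ?_)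
  filter_upwards [hxx, Lp.coeFn_sub x x'] with t ht h2 hs
  rw [h2, Pi.sub_apply, ht hs, sub_self]

/-- It is enough to predict the anti-causal exponential averages. -/
theorem determinedByPast_span_of_expKernel {X : Set Signal}
    (hX : ∀ p : ℝ, 0 < p → ∃ k : ℕ → ℝ → ℝ, (∀ j, k j ∈ causalKernels) ∧ ∀ x ∈ X,
      Tendsto (fun j => eLpNorm (conv (expKernel p) x - conv (k j) x) 2 volume) atTop (𝓝 0)) :
    DeterminedByPast (Submodule.span ℂ X : Set Signal) := by
  refine determinedByPast_of_sub_mem (fun x hx x' hx' => Submodule.sub_mem _ hx hx')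
    fun s x hx hxs => ?_
  have key : ∀ n : ℕ, ∫ r in Set.Ioi s, Real.exp (-((n + 1 : ℝ) * r)) • x r = 0 := by
    intro n
    have hp : (0 : ℝ) < n + 1 := by positivity
    obtain ⟨k, hk, hlim⟩ := hX _ hp
    -- The kernels `k` do not depend on the member of `X`, so the subspace they predict contains the
    -- span.
    have hle : Submodule.span ℂ X ≤
        predictedSubspace (expKernel (n + 1)) k (memLp_expKernel hp) fun j => (hk j).2.1 :=
      Submodule.span_le.2 hlim
    exact integral_exp_smul_eq_zero_of_tendsto hk hxs (hle hx)
  rw [Lp.eq_zero_iff_ae_eq_zero]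
  filter_upwards [hxs, ae_eq_zero_of_laplace_eq_zero key] with t h1 h2
  rcases le_or_gt t s with h | h
  exacts [h1 h, h2 h]

theorem determinedByPast_span {X : Set Signal} (hX : WeaklyPredictable X) :
    DeterminedByPast (Submodule.span ℂ X : Set Signal) :=
  determinedByPast_span_of_expKernel fun _ hp => hX _ (expKernel_mem_antiCausalKernels hp)

/-! ### Parseval's identity and truncated exponentials -/

open scoped ComplexConjugate

theorem integrable_conj_fourier_mul {f : ℝ → ℂ} (hf : Integrable f) (hf2 : MemLp f 2 volume)
    (x : Signal) : Integrable fun ξ => conj (𝓕 f ξ) * (𝓕 x : Signal) ξ := by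
  have hfi : Integrable (hf2.toLp f) := hf.congr hf2.coeFn_toLp.symm
  refine (L2.integrable_inner (𝕜 := ℂ) (𝓕 (hf2.toLp f) : Signal) (𝓕 x : Signal)).congr ?_
  filter_upwards [coeFn_fourier_ae_eq _ hfi] with ξ h
  rw [h, Real.fourier_congr_ae hf2.coeFn_toLp, RCLike.inner_apply, mul_comm]

/-- Parseval's identity for a signal and an integrable square integrable function. -/
theorem integral_conj_mul_eq {f : ℝ → ℂ} (hf : Integrable f) (hf2 : MemLp f 2 volume)
    (x : Signal) :
    ∫ t, conj (f t) * x t = ∫ ξ, conj (𝓕 f ξ) * (𝓕 x : Signal) ξ := by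
  have hfi : Integrable (hf2.toLp f) := hf.congr hf2.coeFn_toLp.symm
  have h := Lp.inner_fourier_eq (hf2.toLp f) x
  rw [L2.inner_def, L2.inner_def] at h
  have h1 : ∫ t, conj (f t) * x t = ∫ t, inner ℂ ((hf2.toLp f : Signal) t) (x t) := by
    refine integral_congr_ae ?_
    filter_upwards [hf2.coeFn_toLp] with t ht
    rw [ht, RCLike.inner_apply, mul_comm]
  have h2 : ∫ ξ, conj (𝓕 f ξ) * (𝓕 x : Signal) ξ
      = ∫ ξ, inner ℂ ((𝓕 (hf2.toLp f) : Signal) ξ) ((𝓕 x : Signal) ξ) := by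
    refine integral_congr_ae ?_
    filter_upwards [coeFn_fourier_ae_eq _ hfi] with ξ h
    rw [h, Real.fourier_congr_ae hf2.coeFn_toLp, RCLike.inner_apply, mul_comm]
  rw [h1, h2, h]

/-- The exponential `e^{c(t - s)}` cut off to `S`. -/
def cutExp (S : Set ℝ) (c : ℂ) (s : ℝ) : ℝ → ℂ :=
  S.indicator fun t => Complex.exp (c * (t - s))

theorem cutExp_eq (S : Set ℝ) (c : ℂ) (s t : ℝ) :
    cutExp S c s t = Complex.exp (-(c * s)) * S.indicator (fun t => Complex.exp (c * t)) t := by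
  by_cases h : t ∈ S
  · simp only [cutExp, Set.indicator_of_mem h, ← Complex.exp_add]
    ring_nf
  · simp [cutExp, h]

theorem integrable_cutExp {S : Set ℝ} (hS : MeasurableSet S) {c : ℂ}
    (h : IntegrableOn (fun t : ℝ => Complex.exp (c * t)) S) (s : ℝ) :
    Integrable (cutExp S c s) := by
  have : cutExp S c s
      = fun t => Complex.exp (-(c * s)) * S.indicator (fun t => Complex.exp (c * t)) t :=
    funext fun t => cutExp_eq S c s t
  rw [this]
  exact ((integrable_indicator_iff hS).2 h).const_mul _

theorem memLp_cutExp {S : Set ℝ} (hS : MeasurableSet S) {c : ℂ}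
    (h : IntegrableOn (fun t : ℝ => Complex.exp (c * t)) S)
    (h2 : IntegrableOn (fun t : ℝ => Complex.exp (2 * c * t)) S) (s : ℝ) :
    MemLp (cutExp S c s) 2 volume := by
  rw [memLp_two_iff_integrable_sq_norm (integrable_cutExp hS h s).1]
  refine (integrable_cutExp hS h2 s).norm.congr (ae_of_all _ fun t => ?_)
  by_cases ht : t ∈ S
  · simp only [cutExp, Set.indicator_of_mem ht]
    rw [← norm_pow, ← Complex.exp_nat_mul]
    push_cast
    ring_nf
  · simp [cutExp, ht]

theorem fourier_cutExp {S : Set ℝ} (hS : MeasurableSet S) (c : ℂ) (s ξ : ℝ) :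
    𝓕 (cutExp S c s) ξ = Complex.exp (-(c * s)) *
      ∫ t in S, Complex.exp ((c - 2 * Real.pi * Complex.I * ξ) * t) := by
  rw [Real.fourier_real_eq_integral_exp_smul, ← integral_indicator hS, ← integral_const_mul]
  congr 1 with t
  rw [cutExp_eq]
  by_cases ht : t ∈ S
  · simp only [Set.indicator_of_mem ht, smul_eq_mul, ← Complex.exp_add]
    push_cast
    ring_nf
  · simp [ht]

theorem integrable_cutExp_Ioi {c : ℂ} (hc : c.re < 0) (s : ℝ) :
    Integrable (cutExp (Set.Ioi s) c s) :=
  integrable_cutExp measurableSet_Ioi (integrableOn_exp_mul_complex_Ioi hc s) s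

theorem memLp_cutExp_Ioi {c : ℂ} (hc : c.re < 0) (s : ℝ) :
    MemLp (cutExp (Set.Ioi s) c s) 2 volume :=
  memLp_cutExp measurableSet_Ioi (integrableOn_exp_mul_complex_Ioi hc s)
    (integrableOn_exp_mul_complex_Ioi (by simp; linarith) s) s

theorem integrable_cutExp_Iic {c : ℂ} (hc : 0 < c.re) (s : ℝ) :
    Integrable (cutExp (Set.Iic s) c s) :=
  integrable_cutExp measurableSet_Iic (integrableOn_exp_mul_complex_Iic hc s) s

theorem memLp_cutExp_Iic {c : ℂ} (hc : 0 < c.re) (s : ℝ) :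
    MemLp (cutExp (Set.Iic s) c s) 2 volume :=
  memLp_cutExp measurableSet_Iic (integrableOn_exp_mul_complex_Iic hc s)
    (integrableOn_exp_mul_complex_Iic (by simpa using hc) s) s

theorem fourier_cutExp_Ioi {c : ℂ} (hc : c.re < 0) (s ξ : ℝ) :
    𝓕 (cutExp (Set.Ioi s) c s) ξ =
      -(Complex.exp (-(2 * Real.pi * Complex.I * ξ * s)) / (c - 2 * Real.pi * Complex.I * ξ)) := by
  rw [fourier_cutExp measurableSet_Ioi, integral_exp_mul_complex_Ioi (by simpa using hc),
    neg_div, mul_neg, ← mul_div_assoc, ← Complex.exp_add]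
  ring_nf

theorem fourier_cutExp_Iic {c : ℂ} (hc : 0 < c.re) (s ξ : ℝ) :
    𝓕 (cutExp (Set.Iic s) c s) ξ =
      Complex.exp (-(2 * Real.pi * Complex.I * ξ * s)) / (c - 2 * Real.pi * Complex.I * ξ) := by
  rw [fourier_cutExp measurableSet_Iic, integral_exp_mul_complex_Iic (by simpa using hc),
    ← mul_div_assoc, ← Complex.exp_add]
  ring_nf

/-! ### The Cauchy transform of the spectrum -/

/-- The integrand of the Cauchy transform of the spectrum of `x`, the time origin being moved
to `s`. -/
def cauchyIntegrand (x : Signal) (s : ℝ) (z : ℂ) (ξ : ℝ) : ℂ :=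
  (𝓕 x : Signal) ξ * Complex.exp (2 * Real.pi * Complex.I * ξ * s) /
    (z - 2 * Real.pi * Complex.I * ξ)

/-- The rate is `-conj z` because Parseval conjugates the first factor; the pairing with `x` then
carries `e^{-z(t - s)}`. -/
theorem conj_fourier_cutExp_Ioi_mul {z : ℂ} (hz : 0 < z.re) (x : Signal) (s ξ : ℝ) :
    conj (𝓕 (cutExp (Set.Ioi s) (-conj z) s) ξ) * (𝓕 x : Signal) ξ
      = cauchyIntegrand x s z ξ := by
  rw [fourier_cutExp_Ioi (by simpa using hz), cauchyIntegrand]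
  simp only [map_neg, map_div₀, map_sub, map_mul, ← Complex.exp_conj, Complex.conj_conj,
    Complex.conj_I, Complex.conj_ofReal, map_ofNat]
  rw [← div_neg]
  ring_nf

theorem conj_fourier_cutExp_Iic_mul {z : ℂ} (hz : z.re < 0) (x : Signal) (s ξ : ℝ) :
    conj (𝓕 (cutExp (Set.Iic s) (-conj z) s) ξ) * (𝓕 x : Signal) ξ
      = -cauchyIntegrand x s z ξ := by
  rw [fourier_cutExp_Iic (by simpa using hz), cauchyIntegrand]
  simp only [map_neg, map_div₀, map_sub, map_mul, ← Complex.exp_conj, Complex.conj_conj,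
    Complex.conj_I, Complex.conj_ofReal, map_ofNat]
  rw [← div_neg]
  ring_nf

theorem integrable_cauchyIntegrand {z : ℂ} (hz : 0 < z.re) (x : Signal) (s : ℝ) :
    Integrable (cauchyIntegrand x s z) := by
  have hc : (-conj z).re < 0 := by simpa using hz
  refine (integrable_conj_fourier_mul (integrable_cutExp_Ioi hc s) (memLp_cutExp_Ioi hc s)
    x).congr (ae_of_all _ fun ξ => ?_)
  exact conj_fourier_cutExp_Ioi_mul hz x s ξ

theorem integral_cauchyIntegrand_of_pos {z : ℂ} (hz : 0 < z.re) (x : Signal) (s : ℝ) :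
    ∫ ξ, cauchyIntegrand x s z ξ = ∫ t in Set.Ioi s, Complex.exp (-(z * (t - s))) * x t := by
  have hc : (-conj z).re < 0 := by simpa using hz
  have h := integral_conj_mul_eq (integrable_cutExp_Ioi hc s) (memLp_cutExp_Ioi hc s) x
  simp_rw [conj_fourier_cutExp_Ioi_mul hz x s] at h
  rw [← h, ← integral_indicator measurableSet_Ioi]
  congr 1 with t
  by_cases ht : t ∈ Set.Ioi s
  · simp only [cutExp, Set.indicator_of_mem ht, ← Complex.exp_conj]
    simp
  · simp only [cutExp, Set.indicator_of_notMem ht]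
    simp

/-- To the left of the imaginary axis the decaying exponential lives on the past, so Parseval turns
the Cauchy integral into an integral of `x` over `(-∞, s]`. -/
theorem integral_cauchyIntegrand_of_neg {z : ℂ} (hz : z.re < 0) {x : Signal} {s : ℝ}
    (hx : ∀ᵐ t : ℝ, t ≤ s → x t = 0) : ∫ ξ, cauchyIntegrand x s z ξ = 0 := by
  have hc : 0 < (-conj z).re := by simpa using hz
  have h := integral_conj_mul_eq (integrable_cutExp_Iic hc s) (memLp_cutExp_Iic hc s) x
  simp_rw [conj_fourier_cutExp_Iic_mul hz x s] at h
  rw [integral_neg] at h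
  rw [← neg_eq_zero, ← h]
  refine integral_eq_zero_of_ae ?_
  filter_upwards [hx] with t ht
  by_cases hs : t ≤ s
  · simp [ht hs]
  · simp [cutExp, hs]

/-- The Cauchy transform of a spectrum that vanishes on an interval is holomorphic across the
interval. -/
theorem differentiableOn_integral_cauchyIntegrand {x : Signal} {a b c : ℝ} (ha : 0 < a) (hc : 0 < c)
    (hx : ∀ᵐ ξ : ℝ, |2 * Real.pi * ξ - b| < a → (𝓕 x : Signal) ξ = 0) (s : ℝ) :
    DifferentiableOn ℂ (fun z => ∫ ξ, cauchyIntegrand x s z ξ)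
      (Metric.ball (c + b * Complex.I) (√(c ^ 2 + a ^ 2))) := by
  set w : ℂ := c + b * Complex.I with hw
  -- `R` is the distance from `w` to `i(b ± a)`, so the ball meets the imaginary axis exactly in the
  -- gap.
  set R := √(c ^ 2 + a ^ 2) with hR
  have hR0 : 0 < R := Real.sqrt_pos.2 (by positivity)
  have hwre : w.re = c := by simp [hw]
  have hwn : ∀ ξ : ℝ, ‖w - 2 * Real.pi * Complex.I * ξ‖ = √(c ^ 2 + (2 * Real.pi * ξ - b) ^ 2) := by
    intro ξ
    rw [Complex.norm_def, Complex.normSq_apply]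
    congr 1
    simp [hw]
    ring
  have hwR : ∀ ξ : ℝ, a ≤ |2 * Real.pi * ξ - b| →
      R ≤ ‖w - 2 * Real.pi * Complex.I * ξ‖ := by
    intro ξ h
    rw [hwn]
    apply Real.sqrt_le_sqrt
    have := sq_le_sq' (by linarith [abs_nonneg (2 * Real.pi * ξ - b)]) h
    rw [sq_abs] at this
    linarith
  have hwc : ∀ ξ : ℝ, c ≤ ‖w - 2 * Real.pi * Complex.I * ξ‖ := by
    intro ξ
    rw [hwn]
    exact Real.le_sqrt_of_sq_le (by nlinarith [sq_nonneg (2 * Real.pi * ξ - b)])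
  have hcwi : Integrable (cauchyIntegrand x s w) :=
    integrable_cauchyIntegrand (by rw [hwre]; exact hc) x s
  have hXm : AEStronglyMeasurable (fun ξ : ℝ => (𝓕 x : Signal) ξ *
      Complex.exp (2 * Real.pi * Complex.I * ξ * s)) volume :=
    (Lp.aestronglyMeasurable _).mul (by fun_prop)
  have hmeas : ∀ z, AEStronglyMeasurable (cauchyIntegrand x s z) volume := by
    intro z
    have hm : Measurable fun ξ : ℝ => (z - 2 * Real.pi * Complex.I * ξ)⁻¹ := by fun_prop
    exact (hXm.mul hm.aestronglyMeasurable).congr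
      (ae_of_all _ fun ξ => (div_eq_mul_inv _ _).symm)
  intro z₀ hz₀
  rw [mem_ball_iff_norm] at hz₀
  set ε := (R - ‖z₀ - w‖) / 2 with hε
  have hε0 : 0 < ε := by rw [hε]; linarith
  -- Off the gap `2πiξ` is at distance at least `R` from `w`, while `‖z - w‖ < R - ε`. The
  -- denominators at `z` and `w` are thus comparable, and domination reduces to integrability at
  -- `w`.
  have hlow : ∀ ξ : ℝ, a ≤ |2 * Real.pi * ξ - b| → ∀ z ∈ Metric.ball z₀ ε,
      ε / R * ‖w - 2 * Real.pi * Complex.I * ξ‖ ≤ ‖z - 2 * Real.pi * Complex.I * ξ‖ := by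
    intro ξ hξ z hz
    rw [mem_ball_iff_norm] at hz
    have h1 := hwR ξ hξ
    have h2 : ‖w - 2 * Real.pi * Complex.I * ξ‖ ≤
        ‖z - 2 * Real.pi * Complex.I * ξ‖ + (R - ε) := by
      calc ‖w - 2 * Real.pi * Complex.I * ξ‖
          = ‖(z - 2 * Real.pi * Complex.I * ξ) - ((z - z₀) + (z₀ - w))‖ := by congr 1; ring
        _ ≤ ‖z - 2 * Real.pi * Complex.I * ξ‖ + (‖z - z₀‖ + ‖z₀ - w‖) :=
          (norm_sub_le _ _).trans (add_le_add le_rfl (norm_add_le _ _))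
        _ ≤ _ := by linarith
    have h3 : R - ε ≤ (1 - ε / R) * ‖w - 2 * Real.pi * Complex.I * ξ‖ := by
      have : 0 ≤ 1 - ε / R := by
        rw [sub_nonneg, div_le_one hR0]
        linarith [norm_nonneg (z₀ - w)]
      calc R - ε = (1 - ε / R) * R := by field_simp
        _ ≤ _ := by gcongr
    linarith
  have hinv : ∀ ξ : ℝ, a ≤ |2 * Real.pi * ξ - b| → ∀ z ∈ Metric.ball z₀ ε,
      ‖z - 2 * Real.pi * Complex.I * ξ‖⁻¹ ≤
        R / ε * ‖w - 2 * Real.pi * Complex.I * ξ‖⁻¹ := by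
    intro ξ hξ z hz
    have h1 : 0 < ‖w - 2 * Real.pi * Complex.I * ξ‖ := hc.trans_le (hwc ξ)
    calc _ ≤ (ε / R * ‖w - 2 * Real.pi * Complex.I * ξ‖)⁻¹ :=
          inv_anti₀ (by positivity) (hlow ξ hξ z hz)
      _ = _ := by rw [mul_inv, inv_div]
  refine (hasDerivAt_integral_of_dominated_loc_of_deriv_le (𝕜 := ℂ)
    (F' := fun z ξ => -((𝓕 x : Signal) ξ * Complex.exp (2 * Real.pi * Complex.I * ξ * s)) /
      (z - 2 * Real.pi * Complex.I * ξ) ^ 2)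
    (bound := fun ξ => (R / ε) ^ 2 * c⁻¹ * ‖cauchyIntegrand x s w ξ‖)
    (Metric.ball_mem_nhds z₀ hε0) (Eventually.of_forall hmeas) ?_ ?_ ?_
    (hcwi.norm.const_mul _) ?_).2.differentiableAt.differentiableWithinAt
  · refine Integrable.mono' (hcwi.norm.const_mul (R / ε)) (hmeas z₀) ?_
    filter_upwards [hx] with ξ hξ
    rcases lt_or_ge |2 * Real.pi * ξ - b| a with h | h
    · simp [cauchyIntegrand, hξ h]
    · have := hinv ξ h z₀ (Metric.mem_ball_self hε0)
      simp only [cauchyIntegrand, norm_div, div_eq_mul_inv _ ‖_‖]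
      rw [mul_left_comm]
      gcongr
  · have hm : Measurable fun ξ : ℝ => ((z₀ - 2 * Real.pi * Complex.I * ξ) ^ 2)⁻¹ := by fun_prop
    exact (hXm.neg.mul hm.aestronglyMeasurable).congr
      (ae_of_all _ fun ξ => (div_eq_mul_inv _ _).symm)
  · filter_upwards [hx] with ξ hξ z hz
    rcases lt_or_ge |2 * Real.pi * ξ - b| a with h | h
    · simp [cauchyIntegrand, hξ h]
    · have h1 := hinv ξ h z hz
      have h2 : ‖w - 2 * Real.pi * Complex.I * ξ‖⁻¹ ≤ c⁻¹ := inv_anti₀ hc (hwc ξ)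
      simp only [cauchyIntegrand, norm_div, norm_neg, norm_pow, div_eq_mul_inv _ (‖_‖),
        div_eq_mul_inv _ (‖_‖ ^ 2)]
      set N := ‖(𝓕 x : Signal) ξ * Complex.exp (2 * Real.pi * Complex.I * ξ * s)‖
      set v := ‖w - 2 * Real.pi * Complex.I * ξ‖⁻¹
      have hv : 0 ≤ v := inv_nonneg.2 (norm_nonneg _)
      rw [← inv_pow]
      calc N * (‖z - 2 * Real.pi * Complex.I * ξ‖⁻¹) ^ 2
          ≤ N * (R / ε * v) ^ 2 := by gcongr
        _ = N * ((R / ε) ^ 2 * (v * v)) := by ring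
        _ ≤ N * ((R / ε) ^ 2 * (c⁻¹ * v)) := by gcongr
        _ = _ := by ring
  · filter_upwards [hx] with ξ hξ z hz
    rcases lt_or_ge |2 * Real.pi * ξ - b| a with h | h
    · simpa [cauchyIntegrand, hξ h] using hasDerivAt_const z (0 : ℂ)
    · have hne : z - 2 * Real.pi * Complex.I * ξ ≠ 0 := by
        rw [← norm_pos_iff]
        have h1 : 0 < ‖w - 2 * Real.pi * Complex.I * ξ‖ := hc.trans_le (hwc ξ)
        exact lt_of_lt_of_le (by positivity) (hlow ξ h z hz)
      have := (hasDerivAt_const z ((𝓕 x : Signal) ξ *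
        Complex.exp (2 * Real.pi * Complex.I * ξ * s))).div
        ((hasDerivAt_id z).sub_const (2 * Real.pi * Complex.I * ξ)) hne
      simpa using! this

/-- A signal vanishing on a half-line `(-∞, s]`, with a spectrum vanishing on an interval, is
zero. -/
theorem eq_zero_of_past_of_spectrum {x : Signal} {a b s : ℝ} (ha : 0 < a)
    (hxs : ∀ᵐ t : ℝ, t ≤ s → x t = 0)
    (hx : ∀ᵐ ξ : ℝ, |2 * Real.pi * ξ - b| < a → (𝓕 x : Signal) ξ = 0) : x = 0 := by
  have hG : ∀ p : ℝ, 0 < p →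
      ∫ t in Set.Ioi s, Complex.exp (-((p + b * Complex.I) * (t - s))) * x t = 0 := by
    intro p hp
    rw [← integral_cauchyIntegrand_of_pos (by simpa using hp)]
    set R := √(p ^ 2 + a ^ 2) with hR
    have hpR : p < R := Real.lt_sqrt_of_sq_lt (by nlinarith)
    have hball : AnalyticOnNhd ℂ (fun z => ∫ ξ, cauchyIntegrand x s z ξ)
        (Metric.ball (p + b * Complex.I) R) :=
      (differentiableOn_integral_cauchyIntegrand ha hp hx s).analyticOnNhd Metric.isOpen_ball
    -- A point of the ball with negative real part: its distance to the centre is `(R + p) / 2 < R`.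
    -- The identity theorem carries the vanishing near it to the centre.
    set z₁ : ℂ := (-((R - p) / 2) : ℝ) + b * Complex.I with hz₁
    have hz₁re : z₁.re < 0 := by simp [hz₁]; linarith
    have hz₁mem : z₁ ∈ Metric.ball ((p : ℂ) + b * Complex.I) R := by
      rw [mem_ball_iff_norm]
      have : z₁ - (p + b * Complex.I) = ((-((R - p) / 2) - p : ℝ) : ℂ) := by
        rw [hz₁]; push_cast; ring
      rw [this, Complex.norm_real, Real.norm_eq_abs, abs_of_neg (by linarith)]
      linarith
    have hev : (fun z => ∫ ξ, cauchyIntegrand x s z ξ) =ᶠ[𝓝 z₁] 0 := by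
      filter_upwards [(isOpen_Iio.preimage Complex.continuous_re).mem_nhds hz₁re] with z hz
      exact integral_cauchyIntegrand_of_neg hz hxs
    exact hball.eqOn_zero_of_preconnected_of_eventuallyEq_zero
      (convex_ball _ _).isPreconnected hz₁mem hev (Metric.mem_ball_self (hp.trans hpR))
  -- The zeros found lie on the line `Im z = b`; modulating by `e^{-ibr}` moves them to the real
  -- axis.
  have hi : IntegrableOn (fun r : ℝ => Complex.exp (-(b * Complex.I * r)) *
      (Real.exp (-(1 * r)) • x r)) (Set.Ioi s) := by
    refine Integrable.bdd_mul (c := 1) (integrableOn_exp_smul x one_pos s) (by fun_prop)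
      (ae_of_all _ fun r => ?_)
    rw [Complex.norm_exp]
    simp
  have h0 := ae_eq_zero_of_integral_exp_smul_eq_zero hi (fun n => by
    have hn := hG (n + 1) (by positivity)
    have e : ∀ r : ℝ, Real.exp (-(n * r)) • (Complex.exp (-(b * Complex.I * r)) *
        (Real.exp (-(1 * r)) • x r)) = Complex.exp (-(((n + 1 : ℝ) + b * Complex.I) * s)) *
          (Complex.exp (-(((n + 1 : ℝ) + b * Complex.I) * (r - s))) * x r) := by
      intro r
      rw [Complex.real_smul, Complex.real_smul, ← mul_assoc, ← mul_assoc, ← mul_assoc,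
        Complex.ofReal_exp, Complex.ofReal_exp, ← Complex.exp_add, ← Complex.exp_add,
        ← Complex.exp_add]
      push_cast
      ring_nf
    simp_rw [e]
    rw [integral_const_mul, hn, mul_zero])
  rw [Lp.eq_zero_iff_ae_eq_zero]
  filter_upwards [hxs, h0] with t h1 h2
  rcases le_or_gt t s with h | h
  · exact h1 h
  · simpa [(Real.exp_pos _).ne'] using h2 h

/-! ### Signals with a spectral gap and band-limited signals -/

theorem fourier_sub_signal (x y : Signal) : (𝓕 (x - y) : Signal) = 𝓕 x - 𝓕 y :=
  map_sub (Lp.fourierTransformₗᵢ ℝ ℂ) x y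

/-- The signals with a spectral gap at the origin. -/
def gapSubspace (a : ℝ) : Submodule ℂ Signal where
  carrier := {x | HasSpectralGap a x}
  zero_mem' := by
    have h : (𝓕 (0 : Signal) : Signal) = 0 := map_zero (Lp.fourierTransformₗᵢ ℝ ℂ)
    simp only [Set.mem_ofPred_eq, HasSpectralGap, h]
    filter_upwards [Lp.coeFn_zero ℂ 2 (volume : Measure ℝ)] with ξ hξ _
    exact hξ
  add_mem' := by
    intro x y hx hy
    have h : (𝓕 (x + y) : Signal) = 𝓕 x + 𝓕 y := map_add (Lp.fourierTransformₗᵢ ℝ ℂ) x y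
    simp only [Set.mem_ofPred_eq, HasSpectralGap, h] at hx hy ⊢
    filter_upwards [hx, hy, Lp.coeFn_add (𝓕 x : Signal) (𝓕 y)] with ξ h1 h2 h3 hξ
    rw [h3, Pi.add_apply, h1 hξ, h2 hξ, add_zero]
  smul_mem' := by
    intro c x hx
    have h : (𝓕 (c • x) : Signal) = c • 𝓕 x := map_smul (Lp.fourierTransformₗᵢ ℝ ℂ) c x
    simp only [Set.mem_ofPred_eq, HasSpectralGap, h] at hx ⊢
    filter_upwards [hx, Lp.coeFn_smul c (𝓕 x : Signal)] with ξ h1 h3 hξ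
    rw [h3, Pi.smul_apply, h1 hξ, smul_zero]

theorem eq_zero_of_hasSpectralGap {a : ℝ} (ha : 0 < a) {x : Signal} (hx : HasSpectralGap a x)
    {s : ℝ} (hxs : ∀ᵐ t : ℝ, t ≤ s → x t = 0) : x = 0 :=
  eq_zero_of_past_of_spectrum (b := 0) ha hxs (by simpa only [sub_zero] using! hx)

theorem determinedByPast_hasSpectralGap {a : ℝ} (ha : 0 < a) :
    DeterminedByPast {x | HasSpectralGap a x} :=
  determinedByPast_of_sub_mem (fun _ hx _ hy => (gapSubspace a).sub_mem hx hy)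
    fun _ _ hx hxs => eq_zero_of_hasSpectralGap ha hx hxs

theorem eq_zero_of_bandLimited {a : ℝ} (ha : 0 < a) {x : Signal} (hx : BandLimited a x)
    {s : ℝ} (hxs : ∀ᵐ t : ℝ, t ≤ s → x t = 0) : x = 0 := by
  -- The gap used is `(a, 3a)`, just outside the band.
  refine eq_zero_of_past_of_spectrum (b := 2 * a) ha hxs ?_
  filter_upwards [hx] with ξ h hξ
  refine h ((?_ : a ≤ 2 * Real.pi * ξ).trans (le_abs_self _))
  linarith [(abs_lt.1 hξ).1]

theorem determinedByPast_bandLimited {a : ℝ} (ha : 0 < a) :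
    DeterminedByPast {x | BandLimited a x} := by
  refine determinedByPast_of_sub_mem (fun x hx y hy => ?_)
    fun _ _ hx hxs => eq_zero_of_bandLimited ha hx hxs
  simp only [Set.mem_ofPred_eq, BandLimited, fourier_sub_signal] at hx hy ⊢
  filter_upwards [hx, hy, Lp.coeFn_sub (𝓕 x : Signal) (𝓕 y)] with ξ h1 h2 h3 hξ
  rw [h3, Pi.sub_apply, h1 hξ, h2 hξ, sub_zero]

/-! ### The low pass filter and translations -/

/-- The frequencies of modulus less than `a`. -/
def band (a : ℝ) : Set ℝ := {ξ | |2 * Real.pi * ξ| < a}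

theorem measurableSet_band (a : ℝ) : MeasurableSet (band a) :=
  measurableSet_lt (by fun_prop) measurable_const

theorem volume_band_lt_top (a : ℝ) : volume (band a) < ∞ := by
  have : band a ⊆ Set.Ioo (-(a / (2 * Real.pi))) (a / (2 * Real.pi)) := by
    intro ξ hξ
    have hpi := Real.two_pi_pos
    obtain ⟨h1, h2⟩ := abs_lt.1 (show |2 * Real.pi * ξ| < a from hξ)
    rw [Set.mem_Ioo, neg_lt, lt_div_iff₀ hpi, lt_div_iff₀ hpi]
    constructor <;> linarith
  exact (measure_mono this).trans_lt (by simp)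

/-- The spectrum of `x`, cut off to the frequencies of modulus less than `a`. -/
def cutSpectrum (a : ℝ) (x : Signal) : Signal :=
  ((Lp.memLp (𝓕 x : Signal)).indicator (measurableSet_band a)).toLp _

theorem coeFn_cutSpectrum (a : ℝ) (x : Signal) :
    (cutSpectrum a x : ℝ → ℂ) =ᵐ[volume] (band a).indicator (𝓕 x : Signal) :=
  MemLp.coeFn_toLp _

/-- The ideal low pass filter. -/
def lowPass (a : ℝ) (x : Signal) : Signal := 𝓕⁻ (cutSpectrum a x)

theorem fourier_lowPass (a : ℝ) (x : Signal) : (𝓕 (lowPass a x) : Signal) = cutSpectrum a x :=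
  FourierTransform.fourier_fourierInv_eq _

theorem bandLimited_lowPass (a : ℝ) (x : Signal) : BandLimited a (lowPass a x) := by
  rw [BandLimited, fourier_lowPass]
  filter_upwards [coeFn_cutSpectrum a x] with ξ h hξ
  rw [h, Set.indicator_of_notMem]
  exact not_lt.2 hξ

theorem hasSpectralGap_sub_lowPass (a : ℝ) (x : Signal) :
    HasSpectralGap a (x - lowPass a x) := by
  rw [HasSpectralGap, fourier_sub_signal, fourier_lowPass]
  filter_upwards [coeFn_cutSpectrum a x, Lp.coeFn_sub (𝓕 x : Signal) (cutSpectrum a x)]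
    with ξ h h2 hξ
  rw [h2, Pi.sub_apply, h, Set.indicator_of_mem (show ξ ∈ band a from hξ), sub_self]

/-- The cut spectrum is square integrable on a set of finite measure, hence integrable, so the
inverse transform is a genuine integral. Reality and translation are read off from it. -/
theorem coeFn_lowPass (a : ℝ) {x : Signal} (hx : Integrable x) :
    (lowPass a x : ℝ → ℂ) =ᵐ[volume] 𝓕⁻ ((band a).indicator (𝓕 (x : ℝ → ℂ))) := by
  have : IsFiniteMeasure (volume.restrict (band a)) :=
    ⟨by simpa using volume_band_lt_top a⟩
  have h1 : Integrable (cutSpectrum a x) := by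
    refine Integrable.congr ?_ (coeFn_cutSpectrum a x).symm
    rw [integrable_indicator_iff (measurableSet_band a)]
    exact ((Lp.memLp (𝓕 x : Signal)).restrict (band a)).integrable (by norm_num)
  have h2 : (cutSpectrum a x : ℝ → ℂ) =ᵐ[volume] (band a).indicator (𝓕 (x : ℝ → ℂ)) := by
    filter_upwards [coeFn_cutSpectrum a x, coeFn_fourier_ae_eq x hx] with ξ h h'
    by_cases hξ : ξ ∈ band a
    · rw [h, Set.indicator_of_mem hξ, Set.indicator_of_mem hξ, h']
    · rw [h, Set.indicator_of_notMem hξ, Set.indicator_of_notMem hξ]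
  filter_upwards [coeFn_fourierInv_ae_eq _ h1] with t ht
  rw [lowPass, ht, Real.fourierInv_congr_ae h2]

theorem neg_mem_band {a ξ : ℝ} : -ξ ∈ band a ↔ ξ ∈ band a := by
  simp [band]

theorem conj_fourier_of_real {f : ℝ → ℂ} (hf : ∀ᵐ t, (f t).im = 0) (ξ : ℝ) :
    conj (𝓕 f ξ) = 𝓕 f (-ξ) := by
  rw [Real.fourier_real_eq_integral_exp_smul, Real.fourier_real_eq_integral_exp_smul,
    ← integral_conj]
  refine integral_congr_ae ?_
  filter_upwards [hf] with t ht
  have : conj (f t) = f t := Complex.conj_eq_iff_im.2 ht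
  simp only [smul_eq_mul, map_mul, ← Complex.exp_conj, this, Complex.conj_ofReal, Complex.conj_I]
  push_cast
  ring_nf

/-- A real signal has a Hermitian spectrum, and cutting it off to a symmetric band preserves this.
-/
theorem isRealValued_lowPass (a : ℝ) {x : Signal} (hx : Integrable x) (hr : IsRealValued x) :
    IsRealValued (lowPass a x) := by
  filter_upwards [coeFn_lowPass a hx] with t ht
  rw [ht, ← Complex.conj_eq_iff_im, Real.fourierInv_eq', ← integral_conj, ← integral_neg_eq_self]
  congr 1 with ξ
  have h : conj ((band a).indicator (𝓕 (x : ℝ → ℂ)) (-ξ))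
      = (band a).indicator (𝓕 (x : ℝ → ℂ)) ξ := by
    by_cases hξ : ξ ∈ band a
    · rw [Set.indicator_of_mem hξ, Set.indicator_of_mem (neg_mem_band.2 hξ),
        conj_fourier_of_real hr, neg_neg]
    · rw [Set.indicator_of_notMem hξ, Set.indicator_of_notMem (mt neg_mem_band.1 hξ), map_zero]
  rw [smul_eq_mul, smul_eq_mul, map_mul, h, ← Complex.exp_conj]
  simp [map_ofNat]

theorem fourier_of_ae_eq_comp_sub {f g : ℝ → ℂ} {T : ℝ} (h : ∀ᵐ t, g t = f (t - T)) (ξ : ℝ) :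
    𝓕 g ξ = Complex.exp (-(2 * Real.pi * T * ξ * Complex.I)) * 𝓕 f ξ := by
  rw [Real.fourier_congr_ae h, Real.fourier_real_eq_integral_exp_smul,
    Real.fourier_real_eq_integral_exp_smul, ← integral_const_mul,
    ← integral_add_right_eq_self _ T]
  congr 1 with t
  rw [add_sub_cancel_right, smul_eq_mul, smul_eq_mul, ← mul_assoc, ← Complex.exp_add]
  push_cast
  ring_nf

/-- The low pass filter commutes with translations. -/
theorem lowPass_of_ae_eq_comp_sub (a : ℝ) {x y : Signal} (hx : Integrable x) (hy : Integrable y)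
    {T : ℝ} (h : ∀ᵐ t, y t = x (t - T)) : ∀ᵐ t, lowPass a y t = lowPass a x (t - T) := by
  have h1 := (measurePreserving_sub_right volume T).quasiMeasurePreserving.ae (coeFn_lowPass a hx)
  filter_upwards [h1, coeFn_lowPass a hy] with t ht ht'
  rw [ht, ht', Real.fourierInv_eq', Real.fourierInv_eq']
  congr 1 with ξ
  by_cases hξ : ξ ∈ band a
  · rw [Set.indicator_of_mem hξ, Set.indicator_of_mem hξ, fourier_of_ae_eq_comp_sub h,
      smul_eq_mul, smul_eq_mul, ← mul_assoc, ← Complex.exp_add]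
    simp only [RCLike.inner_apply, conj_trivial]
    push_cast
    ring_nf
  · simp [hξ]

theorem conv_of_ae_eq_comp_sub (k : ℝ → ℝ) {x y : Signal} {T : ℝ}
    (h : ∀ᵐ t, y t = x (t - T)) (t : ℝ) : conv k y t = conv k x (t - T) := by
  unfold conv
  rw [convolution_def, convolution_def]
  refine integral_congr_ae ?_
  filter_upwards [(Measure.measurePreserving_sub_left volume t).quasiMeasurePreserving.ae h]
    with u hu
  rw [hu, sub_right_comm]

/-- Delaying a signal delays the prediction error without changing its norm; kernels that predict a
signal therefore predict its translates. -/
theorem eLpNorm_conv_of_ae_eq_comp_sub {k k' : ℝ → ℝ} (hk : MemLp k 2 volume)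
    (hk' : MemLp k' 2 volume) {x y : Signal} {T : ℝ} (h : ∀ᵐ t, y t = x (t - T)) :
    eLpNorm (conv k y - conv k' y) 2 volume = eLpNorm (conv k x - conv k' x) 2 volume := by
  have e : conv k y - conv k' y = (conv k x - conv k' x) ∘ fun t => t - T := by
    ext t
    simp [conv_of_ae_eq_comp_sub _ h]
  rw [e, eLpNorm_comp_measurePreserving
    ((aestronglyMeasurable_conv hk x).sub (aestronglyMeasurable_conv hk' x))
    (measurePreserving_sub_right volume T)]

theorem norm_eq_of_ae_eq_comp_sub {x y : Signal} {T : ℝ} (h : ∀ᵐ t, y t = x (t - T)) :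
    ‖y‖ = ‖x‖ := by
  rw [Lp.norm_def, Lp.norm_def, eLpNorm_congr_ae h,
    ← eLpNorm_comp_measurePreserving (Lp.aestronglyMeasurable x)
      (measurePreserving_sub_right volume T)]
  rfl

/-- A signal that is an eigenvector of a translation vanishes. -/
theorem eq_zero_of_smul_eq_smul {x y : Signal} (h : ∀ᵐ t, y t = x (t - 1)) {c d : ℂ}
    (hcd : c ≠ 0 ∨ d ≠ 0) (he : c • x = d • y) : x = 0 := by
  by_contra hx
  have hn := congrArg norm he
  rw [norm_smul, norm_smul, norm_eq_of_ae_eq_comp_sub h] at hn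
  have hn' : ‖c‖ = ‖d‖ := mul_right_cancel₀ (norm_ne_zero_iff.2 hx) hn
  have hc : ‖c‖ ≠ 0 := by
    rcases hcd with h | h
    · exact norm_ne_zero_iff.2 h
    · rw [hn']; exact norm_ne_zero_iff.2 h
  -- With `‖c‖ = ‖d‖ ≠ 0`, `|x|` is 1-periodic. The energy on `(-∞, t]` is then unchanged under `t ↦
  -- t - 1` but tends to zero at `-∞`, so it vanishes.
  have hper : ∀ᵐ t, ‖x t‖ₑ = ‖x (t - 1)‖ₑ := by
    filter_upwards [h, Lp.coeFn_smul c x, Lp.coeFn_smul d y] with t h1 h2 h3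
    have h4 : c * x t = d * y t := by
      rw [← smul_eq_mul, ← smul_eq_mul, ← Pi.smul_apply, ← h2, ← Pi.smul_apply, ← h3, he]
    have h5 := congrArg norm h4
    rw [norm_mul, norm_mul, ← hn', h1] at h5
    rw [← ofReal_norm, ← ofReal_norm, mul_left_cancel₀ hc h5]
  set Φ : ℝ → ℝ≥0∞ := fun t => ∫⁻ r in Set.Iic t, ‖x r‖ₑ ^ 2 with hΦ
  have hfin : ∫⁻ r, ‖x r‖ₑ ^ 2 ≠ ∞ := by
    have := lintegral_rpow_enorm_lt_top_of_eLpNorm_lt_top (p := 2) (by norm_num) (by norm_num)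
      (Lp.memLp x).2
    simpa using this.ne
  have hstep : ∀ t, Φ (t - 1) = Φ t := by
    intro t
    have hpre : (fun r : ℝ => r - 1) ⁻¹' Set.Iic (t - 1) = Set.Iic t := by
      ext r; simp
    rw [hΦ]
    simp only
    rw [← (measurePreserving_sub_right volume (1 : ℝ)).setLIntegral_comp_preimage_emb
      (MeasurableEquiv.subRight (1 : ℝ)).measurableEmbedding, hpre]
    refine lintegral_congr_ae (ae_restrict_of_ae ?_)
    filter_upwards [hper] with r hr
    rw [hr]
  have hiter : ∀ (n : ℕ) t, Φ (t - n) = Φ t := by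
    intro n
    induction n with
    | zero => simp
    | succ n ih =>
      intro t
      rw [← ih t, ← hstep (t - n)]
      push_cast
      ring_nf
  have hlim : ∀ t, Φ t = 0 := by
    intro t
    have : IsFiniteMeasure (volume.withDensity fun r => ‖x r‖ₑ ^ 2) :=
      isFiniteMeasure_withDensity hfin
    have hempty : ⋂ n : ℕ, Set.Iic (t - (n : ℝ)) = ∅ := by
      refine Set.eq_empty_of_forall_notMem fun r hr => ?_
      obtain ⟨n, hn⟩ := exists_nat_gt (t - r)
      have := Set.mem_Iic.1 (Set.mem_iInter.1 hr n)
      linarith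
    have h3 := tendsto_measure_iInter_atTop (μ := volume.withDensity fun r => ‖x r‖ₑ ^ 2)
      (s := fun n : ℕ => Set.Iic (t - (n : ℝ))) (fun _ => measurableSet_Iic.nullMeasurableSet)
      (fun m n hmn => Set.Iic_subset_Iic.2 (by
        have : (m : ℝ) ≤ n := by exact_mod_cast hmn
        linarith)) ⟨0, measure_ne_top _ _⟩
    rw [hempty, measure_empty] at h3
    refine tendsto_nhds_unique (tendsto_const_nhds.congr fun n => ?_) h3
    rw [Function.comp_apply, withDensity_apply _ measurableSet_Iic]
    exact (hiter n t).symm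
  apply hx
  rw [Lp.eq_zero_iff_ae_eq_zero]
  have hz : ∀ n : ℕ, ∀ᵐ r : ℝ, r ≤ n → x r = 0 := by
    intro n
    have h1 := hlim n
    rw [hΦ] at h1
    simp only at h1
    rw [lintegral_eq_zero_iff' ((Lp.aestronglyMeasurable x).enorm.pow_const 2).restrict] at h1
    refine (ae_restrict_iff' (measurableSet_Iic (a := (n : ℝ)))).1 ?_
    filter_upwards [h1] with r hr
    simpa using hr
  filter_upwards [ae_all_iff.2 hz] with r hr
  obtain ⟨n, hn⟩ := exists_nat_ge r
  exact hr n hn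

/-! ### The counterexample -/

/-- The indicator of `[T, T + 1]`. -/
def box (T : ℝ) : Signal :=
  indicatorConstLp 2 (measurableSet_Icc (a := T) (b := T + 1)) (by simp) (1 : ℂ)

theorem coeFn_box (T : ℝ) :
    (box T : ℝ → ℂ) =ᵐ[volume] (Set.Icc T (T + 1)).indicator fun _ => 1 :=
  indicatorConstLp_coeFn

theorem integrable_box (T : ℝ) : Integrable (box T) := by
  refine Integrable.congr ?_ (coeFn_box T).symm
  exact (integrable_indicator_iff measurableSet_Icc).2 (integrableOn_const (by simp))

theorem isRealValued_box (T : ℝ) : IsRealValued (box T) := by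
  filter_upwards [coeFn_box T] with t ht
  rw [ht]
  by_cases h : t ∈ Set.Icc T (T + 1)
  · rw [Set.indicator_of_mem h, Complex.one_im]
  · rw [Set.indicator_of_notMem h, Complex.zero_im]

theorem box_past (T : ℝ) {s : ℝ} (hs : s < T) : ∀ᵐ t : ℝ, t ≤ s → box T t = 0 := by
  filter_upwards [coeFn_box T] with t ht hts
  rw [ht, Set.indicator_of_notMem]
  exact fun h => absurd h.1 (by linarith)

theorem box_ne_zero (T : ℝ) : box T ≠ 0 := by
  intro h
  have := congrArg norm h
  rw [box, norm_indicatorConstLp (by norm_num) (by norm_num)] at this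
  simp at this

theorem box_one_ae_eq : ∀ᵐ t, box 1 t = box 0 (t - 1) := by
  filter_upwards [coeFn_box 1,
    (measurePreserving_sub_right volume 1).quasiMeasurePreserving.ae (coeFn_box 0)] with t h1 h2
  rw [h1, h2]
  simp only [Set.indicator_apply, Set.mem_Icc]
  congr 1
  apply propext
  constructor <;> rintro ⟨h, h'⟩ <;> constructor <;> linarith

theorem isRealValued_sub {x y : Signal} (hx : IsRealValued x) (hy : IsRealValued y) :
    IsRealValued (x - y) := by
  filter_upwards [hx, hy, Lp.coeFn_sub x y] with t h1 h2 h3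
  rw [h3, Pi.sub_apply, Complex.sub_im, h1, h2, sub_zero]

/-- The high frequency part of `box T`. -/
def highBox (a T : ℝ) : Signal := box T - lowPass a (box T)

theorem highBox_one_ae_eq (a : ℝ) : ∀ᵐ t, highBox a 1 t = highBox a 0 (t - 1) := by
  filter_upwards [box_one_ae_eq,
    lowPass_of_ae_eq_comp_sub a (integrable_box 0) (integrable_box 1) box_one_ae_eq,
    Lp.coeFn_sub (box 1) (lowPass a (box 1)),
    (measurePreserving_sub_right volume (1 : ℝ)).quasiMeasurePreserving.ae
      (Lp.coeFn_sub (box 0) (lowPass a (box 0)))] with t h1 h2 h3 h4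
  rw [highBox, highBox, h3, h4, Pi.sub_apply, Pi.sub_apply, h1, h2]

/-- Otherwise the box would be a nonzero band-limited signal with a vanishing past. -/
theorem highBox_zero_ne_zero {a : ℝ} (ha : 0 < a) : highBox a 0 ≠ 0 := by
  intro h
  have hb : BandLimited a (box 0) := by
    rw [sub_eq_zero.1 h]; exact bandLimited_lowPass a _
  exact box_ne_zero 0 (eq_zero_of_bandLimited ha hb (box_past 0 (neg_one_lt_zero)))

theorem determinedByPast_span_pair {a : ℝ} (ha : 0 < a) :
    DeterminedByPast
      (Submodule.span ℂ {lowPass a (box 0), highBox a 1} : Set Signal) := by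
  refine determinedByPast_of_sub_mem (fun x hx x' hx' => Submodule.sub_mem _ hx hx')
    fun s x hx hxs => ?_
  obtain ⟨c, d, rfl⟩ := Submodule.mem_span_pair.1 hx
  -- Subtracting `c • box 0`, itself zero before time 0, cancels the low frequencies without
  -- disturbing the remote past.
  have hdiff : c • lowPass a (box 0) + d • highBox a 1 - c • box 0
      = d • highBox a 1 - c • highBox a 0 := by
    simp only [highBox, smul_sub]
    abel
  have hgap : HasSpectralGap a (d • highBox a 1 - c • highBox a 0) :=
    (gapSubspace a).sub_mem
      ((gapSubspace a).smul_mem d (hasSpectralGap_sub_lowPass a (box 1)))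
      ((gapSubspace a).smul_mem c (hasSpectralGap_sub_lowPass a (box 0)))
  have hzero : d • highBox a 1 - c • highBox a 0 = 0 := by
    refine eq_zero_of_hasSpectralGap ha hgap (s := min s (-1)) ?_
    rw [← hdiff]
    filter_upwards [hxs, box_past 0 neg_one_lt_zero, Lp.coeFn_smul c (box 0),
      Lp.coeFn_sub (c • lowPass a (box 0) + d • highBox a 1) (c • box 0)] with t h1 h2 h3 h4 ht
    rw [h4, Pi.sub_apply, h1 (ht.trans (min_le_left _ _)), h3, Pi.smul_apply,
      h2 (ht.trans (min_le_right _ _)), smul_zero, sub_zero]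
  by_cases hcd : c ≠ 0 ∨ d ≠ 0
  · exact absurd (eq_zero_of_smul_eq_smul (highBox_one_ae_eq a) hcd (sub_eq_zero.1 hzero).symm)
      (highBox_zero_ne_zero ha)
  · push Not at hcd
    simp [hcd.1, hcd.2]

/-- The same kernels would predict `highBox a 0`, a translate of the second signal, and so the sum
`box 0`, whose past is zero although it is not. -/
theorem not_weaklyPredictable_pair (a : ℝ) :
    ¬ WeaklyPredictable {lowPass a (box 0), highBox a 1} := by
  intro hU
  have hw : DeterminedByPast (Submodule.span ℂ {box 0} : Set Signal) := by
    refine determinedByPast_span_of_expKernel fun p hp => ?_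
    obtain ⟨k, hk, hlim⟩ := hU _ (expKernel_mem_antiCausalKernels hp)
    refine ⟨k, hk, ?_⟩
    rintro x rfl
    set S := predictedSubspace (expKernel p) k (memLp_expKernel hp) fun j => (hk j).2.1
    have h1 : lowPass a (box 0) ∈ S := hlim _ (by simp)
    have h2 : highBox a 0 ∈ S :=
      (hlim (highBox a 1) (by simp)).congr fun j =>
        eLpNorm_conv_of_ae_eq_comp_sub (memLp_expKernel hp) (hk j).2.1 (highBox_one_ae_eq a)
    have h3 : box 0 ∈ S := by
      have := S.add_mem h1 h2
      rwa [highBox, add_sub_cancel] at this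
    exact h3
  refine box_ne_zero 0 (hw (-1) _ (Submodule.mem_span_singleton_self _) _ (Submodule.zero_mem _) ?_)
  filter_upwards [box_past 0 neg_one_lt_zero, Lp.coeFn_zero ℂ 2 (volume : Measure ℝ)]
    with t h1 h2 ht
  rw [h1 ht, h2, Pi.zero_apply]

end WeakPrediction

end

theorem proposition1 :
    (∀ X : Set WeakPrediction.Signal, WeakPrediction.WeaklyPredictable X →
      WeakPrediction.DeterminedByPast (Submodule.span ℂ X : Set WeakPrediction.Signal)) ∧
    (∃ U : Set WeakPrediction.Signal,
      (∃ a : ℝ, 0 < a ∧ ∃ x₁ x₂ : WeakPrediction.Signal, U = {x₁, x₂} ∧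
        WeakPrediction.IsRealValued x₁ ∧ WeakPrediction.IsRealValued x₂ ∧
        WeakPrediction.BandLimited a x₁ ∧ WeakPrediction.HasSpectralGap a x₂ ∧
        WeakPrediction.DeterminedByPast {x | WeakPrediction.BandLimited a x} ∧
        WeakPrediction.DeterminedByPast {x | WeakPrediction.HasSpectralGap a x}) ∧
      WeakPrediction.DeterminedByPast (Submodule.span ℂ U : Set WeakPrediction.Signal) ∧
      ¬ WeakPrediction.WeaklyPredictable U) := by
  open WeakPrediction in
  have hr : ∀ T, IsRealValued (lowPass 1 (box T)) := fun T =>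
    isRealValued_lowPass 1 (integrable_box T) (isRealValued_box T)
  exact ⟨fun _ hX => determinedByPast_span hX,
    {lowPass 1 (box 0), highBox 1 1},
    ⟨1, one_pos, _, _, rfl, hr 0, isRealValued_sub (isRealValued_box 1) (hr 1),
      bandLimited_lowPass 1 _, hasSpectralGap_sub_lowPass 1 _,
      determinedByPast_bandLimited one_pos, determinedByPast_hasSpectralGap one_pos⟩,
    determinedByPast_span_pair one_pos, not_weaklyPredictable_pair 1⟩
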